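/- Let $\mathbb{C}^*$ carry the trivial action of every group. For a finite group $G$ and a 2-cocycle $f\in Z^2(G,\mathbb{C}^*)$, the twisted group algebra $\mathbb{C}^fG$ is the complex algebra with vector space basis $\{u_g\}_{g\in G}$ and multiplication determined by $u_gu_h=f(g,h)u_{gh}$. The cocycle $f$, and likewise its class $[f]\in H^2(G,\mathbb{C}^*)$, is called non-degenerate if $\mathbb{C}^fG\cong M_n(\mathbb{C})$ for some $n$; the group $G$ is of central type if it admits a non-degenerate 2-cocycle. The group $\mathrm{Aut}(G)$ acts on $H^2(G,\mathbb{C}^*)$ by $\phi([f])=[\phi(f)]$, where $\phi(f)(g,h)=f(\phi^{-1}(g),\phi^{-1}(h))$. An action $\eta:K\to\mathrm{Aut}(G)$ of a group $K$ on $G$ is symplectic if there is a non-degenerate class $c\in H^2(G,\mathbb{C}^*)$ such that $\eta(k)(c)=c$ for all $k\in K$. For $m\ge 1$ and generators $\sigma,\tau$ of $C_m\times C_m=\langle\sigma\rangle\times\langle\tau\rangle$, the matrix of an automorphism $\phi$ with $\phi(\sigma)=\sigma^{i_1}\tau^{j_1}$ and $\phi(\tau)=\sigma^{i_2}\tau^{j_2}$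 is $[\phi]=\begin{pmatrix} i_1&i_2\\ j_1&j_2\end{pmatrix}$ over $\mathbb{Z}/m$, and $\mathrm{SL}_2(m)=\{\phi\in\mathrm{Aut}(C_m\times C_m) : \det[\phi]\equiv 1 \pmod m\}$. **Theorem.** Let $G=N\rtimes_\eta K$ be the semidirect product of two finite groups $N$ and $K$ of coprime orders via an action $\eta:K\to\mathrm{Aut}(N)$. Then $G$ is of central type if and only if $N$ and $K$ are both of central type and the action $\eta$ is symplectic. In particular, if $N=C_m\times C_m$, then $N\rtimes_\eta K$ is of central type if and only if $K$ is of central type and $\eta(K)\le \mathrm{SL}_2(m)$. -/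

import Mathlib

universe u v

open scoped Matrix

noncomputable section

namespace CentralType

section Cohomology

variable (G : Type u) [Group G]

/-- The group `Z²(G, ℂˣ)` of 2-cocycles of `G` with values in the trivial `G`-module `ℂˣ`
(under pointwise multiplication). -/
def twoCocycles : Subgroup (G → G → ℂˣ) where
  carrier := {f | ∀ g h k : G, f g h * f (g * h) k = f h k * f g (h * k)}
  one_mem' := fun _ _ _ => rfl
  mul_mem' := by
    intro a b ha hb g h k
    simp only [Pi.mul_apply]
    rw [mul_mul_mul_comm, ha g h k, hb g h k, mul_mul_mul_comm]
  inv_mem' := by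
    intro a ha g h k
    simp only [Pi.inv_apply]
    rw [← mul_inv, ha g h k, mul_inv]

/-- The coboundary map, sending a function `c : G → ℂˣ` to the 2-cocycle
`(g, h) ↦ c(g) c(h) c(gh)⁻¹`. -/
def coboundary : (G → ℂˣ) →* twoCocycles G where
  toFun c := ⟨fun g h => c g * c h * (c (g * h))⁻¹, fun g h k => by
    simp only [mul_assoc g h k]
    have e1 : c g * c h * (c (g * h))⁻¹ * (c (g * h) * c k * (c (g * (h * k)))⁻¹)
        = c g * c h * c k * (c (g * (h * k)))⁻¹ := by
      simp [mul_assoc]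
    have e2 : c h * c k * (c (h * k))⁻¹ * (c g * c (h * k) * (c (g * (h * k)))⁻¹)
        = c g * c h * c k * (c (g * (h * k)))⁻¹ := by
      rw [mul_comm (c g) (c (h * k))]
      simp only [mul_assoc, inv_mul_cancel_left]
      rw [mul_left_comm (c k), mul_left_comm (c h)]
    rw [e1, e2]⟩
  map_one' := by
    apply Subtype.ext
    funext g h
    simp
  map_mul' a b := by
    apply Subtype.ext
    funext g h
    simp only [Pi.mul_apply, Subgroup.coe_mul, mul_inv]
    rw [mul_mul_mul_comm (a g), mul_mul_mul_comm (a g * a h)]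

/-- The second cohomology group `H²(G, ℂˣ)` with trivial action on `ℂˣ`:
2-cocycles modulo 2-coboundaries. -/
def H2 : Type u := twoCocycles G ⧸ (coboundary G).range

instance : CommGroup (H2 G) :=
  inferInstanceAs (CommGroup (twoCocycles G ⧸ (coboundary G).range))

/-- The cohomology class `[f]` of a 2-cocycle `f`. -/
def H2.mk : twoCocycles G →* H2 G := QuotientGroup.mk' (coboundary G).range

variable {G}

/-- The action of `Aut(G)` on 2-cocycles: `φ(f)(g, h) = f(φ⁻¹(g), φ⁻¹(h))`. -/
def autCocycle (φ : MulAut G) : twoCocycles G →* twoCocycles G where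
  toFun f := ⟨fun g h => f.1 (φ⁻¹ g) (φ⁻¹ h), fun g h k => by
    simp only [map_mul]
    exact f.2 _ _ _⟩
  map_one' := rfl
  map_mul' _ _ := rfl

/-- The action of `Aut(G)` on cohomology classes: `φ([f]) = [φ(f)]`. -/
def autH2 (φ : MulAut G) : H2 G →* H2 G :=
  QuotientGroup.map _ _ (autCocycle φ) (by
    rintro _ ⟨c, rfl⟩
    refine ⟨fun g => c (φ⁻¹ g), ?_⟩
    apply Subtype.ext
    funext g h
    simp [coboundary, autCocycle, map_mul])

instance : MulAction (MulAut G) (H2 G) where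
  smul φ c := autH2 φ c
  one_smul c := by
    obtain ⟨f, rfl⟩ := QuotientGroup.mk'_surjective _ c
    rfl
  mul_smul φ ψ c := by
    obtain ⟨f, rfl⟩ := QuotientGroup.mk'_surjective _ c
    change H2.mk G (autCocycle (φ * ψ) f) = H2.mk G (autCocycle φ (autCocycle ψ f))
    congr 1

end Cohomology

section TwistedGroupAlgebra

variable {G : Type u} [Group G]

/-- The twisted group algebra `ℂ^f G`: the complex vector space with basis `(u_g)_{g ∈ G}`. -/
def TwistedGroupAlgebra (_f : twoCocycles G) : Type u := G →₀ ℂ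

namespace TwistedGroupAlgebra

variable (f : twoCocycles G)

instance : AddCommGroup (TwistedGroupAlgebra f) := inferInstanceAs (AddCommGroup (G →₀ ℂ))

instance : Module ℂ (TwistedGroupAlgebra f) := inferInstanceAs (Module ℂ (G →₀ ℂ))

/-- The basis `(u_g)_{g ∈ G}` of `ℂ^f G`. -/
def basis : Module.Basis G ℂ (TwistedGroupAlgebra f) :=
  Module.Basis.ofRepr (LinearEquiv.refl ℂ (G →₀ ℂ))

/-- The bilinear multiplication of `ℂ^f G`, determined by `u_g u_h = f(g, h) u_{gh}`. -/
def mulMap : TwistedGroupAlgebra f →ₗ[ℂ] TwistedGroupAlgebra f →ₗ[ℂ] TwistedGroupAlgebra f :=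
  (basis f).constr ℂ fun g => (basis f).constr ℂ fun h => (f.1 g h : ℂ) • basis f (g * h)

instance : Mul (TwistedGroupAlgebra f) := ⟨fun a b => mulMap f a b⟩

instance : One (TwistedGroupAlgebra f) := ⟨((f.1 1 1)⁻¹ : ℂˣ).val • basis f 1⟩

lemma mul_def (a b : TwistedGroupAlgebra f) : a * b = mulMap f a b := rfl

lemma one_def : (1 : TwistedGroupAlgebra f) = ((f.1 1 1)⁻¹ : ℂˣ).val • basis f 1 := rfl

lemma mulMap_basis (g h : G) :
    mulMap f (basis f g) (basis f h) = (f.1 g h : ℂ) • basis f (g * h) := by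
  simp [mulMap]

lemma cocycle_one_left (g : G) : f.1 1 g = f.1 1 1 := by
  have h := f.2 1 1 g
  simp only [one_mul] at h
  exact (mul_right_cancel h).symm

lemma cocycle_one_right (g : G) : f.1 g 1 = f.1 1 1 := by
  have h := f.2 g 1 1
  simp only [mul_one] at h
  exact mul_right_cancel h

lemma one_mulMap : mulMap f 1 = LinearMap.id := by
  refine (basis f).ext fun g => ?_
  rw [one_def, map_smul, LinearMap.smul_apply, mulMap_basis, cocycle_one_left f g, one_mul, smul_smul,
    ← Units.val_mul, inv_mul_cancel, Units.val_one, one_smul, LinearMap.id_apply]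

lemma mulMap_one : (mulMap f).flip 1 = LinearMap.id := by
  refine (basis f).ext fun g => ?_
  rw [LinearMap.flip_apply, one_def, map_smul, mulMap_basis, cocycle_one_right f g, mul_one, smul_smul,
    ← Units.val_mul, inv_mul_cancel, Units.val_one, one_smul, LinearMap.id_apply]

lemma basis_induction {p : TwistedGroupAlgebra f → Prop} (a : TwistedGroupAlgebra f)
    (coe : ∀ g, p (basis f g)) (zero : p 0) (add : ∀ x y, p x → p y → p (x + y))
    (smul : ∀ (r : ℂ) x, p x → p (r • x)) : p a := by
  refine Submodule.span_induction (p := fun x _ => p x) ?_ zero (fun x y _ _ => add x y)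
    (fun r x _ => smul r x) ((basis f).mem_span a)
  rintro _ ⟨g, rfl⟩
  exact coe g

lemma mulMap_assoc (a b c : TwistedGroupAlgebra f) :
    mulMap f (mulMap f a b) c = mulMap f a (mulMap f b c) := by
  refine basis_induction f (p := fun a => mulMap f (mulMap f a b) c = mulMap f a (mulMap f b c)) a
    (fun g => ?_) (by simp) (fun x y hx hy => by simp [hx, hy])
    (fun r x hx => by simp [hx])
  refine basis_induction f
    (p := fun b => mulMap f (mulMap f (basis f g) b) c = mulMap f (basis f g) (mulMap f b c)) b
    (fun h => ?_) (by simp) (fun x y hx hy => by simp [hx, hy])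
    (fun r x hx => by simp [hx])
  refine basis_induction f
    (p := fun c => mulMap f (mulMap f (basis f g) (basis f h)) c =
      mulMap f (basis f g) (mulMap f (basis f h) c)) c
    (fun k => ?_) (by simp) (fun x y hx hy => by simp [hx, hy])
    (fun r x hx => by simp [hx])
  simp only [mulMap_basis, map_smul, LinearMap.smul_apply, smul_smul, mul_assoc]
  congr 1
  have h1 := congrArg Units.val (f.2 g h k)
  simpa only [Units.val_mul] using h1

instance : Ring (TwistedGroupAlgebra f) :=
  { (inferInstance : AddCommGroup (TwistedGroupAlgebra f)),
    (inferInstance : Mul (TwistedGroupAlgebra f)),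
    (inferInstance : One (TwistedGroupAlgebra f)) with
    left_distrib := fun a b c => by simp [mul_def]
    right_distrib := fun a b c => by simp [mul_def]
    zero_mul := fun a => by simp [mul_def]
    mul_zero := fun a => by simp [mul_def]
    mul_assoc := fun a b c => mulMap_assoc f a b c
    one_mul := fun a => by rw [mul_def, one_mulMap, LinearMap.id_apply]
    mul_one := fun a => by
      rw [mul_def, ← LinearMap.flip_apply, mulMap_one, LinearMap.id_apply] }

instance : Algebra ℂ (TwistedGroupAlgebra f) :=
  Algebra.ofModule (fun r x y => by simp [mul_def]) (fun r x y => by simp [mul_def])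

end TwistedGroupAlgebra

/-- A 2-cocycle `f` is non-degenerate if the twisted group algebra `ℂ^f G` is isomorphic to a
matrix algebra `M_n(ℂ)`. -/
def IsNondegenerateCocycle (f : twoCocycles G) : Prop :=
  ∃ n : ℕ, Nonempty (TwistedGroupAlgebra f ≃ₐ[ℂ] Matrix (Fin n) (Fin n) ℂ)

/-- A class in `H²(G, ℂˣ)` is non-degenerate if it is the class of a non-degenerate cocycle
(cohomologous cocycles have isomorphic twisted group algebras). -/
def IsNondegenerate (c : H2 G) : Prop :=
  ∃ f : twoCocycles G, H2.mk G f = c ∧ IsNondegenerateCocycle f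

variable (G) in
/-- `G` is of central type if it admits a non-degenerate 2-cocycle. -/
def IsOfCentralType : Prop :=
  ∃ f : twoCocycles G, IsNondegenerateCocycle f

/-- The stabilizer `Sp(c)` of a class `c ∈ H²(G, ℂˣ)` in `Aut(G)`. -/
def symplecticGroup (c : H2 G) : Subgroup (MulAut G) := MulAction.stabilizer (MulAut G) c

/-- An action `η` of a group `K` on `G` is symplectic if there is a non-degenerate class
`c ∈ H²(G, ℂˣ)` with `η(K) ≤ Sp(c)`. -/
def IsSymplectic {K : Type v} [Group K] (η : K →* MulAut G) : Prop :=
  ∃ c : H2 G, IsNondegenerate c ∧ η.range ≤ symplecticGroup c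

end TwistedGroupAlgebra

section RankTwo

/-- The group `C_m × C_m`, where `C_m` is the cyclic group `ℤ/m` written multiplicatively. -/
abbrev CyclicSq (m : ℕ) : Type := Multiplicative (ZMod m) × Multiplicative (ZMod m)

variable (m : ℕ)

/-- The standard generators `σ = (x, 1)` (index `0`) and `τ = (1, x)` (index `1`) of
`C_m × C_m`, where `x` generates `C_m`. -/
def gen : Fin 2 → CyclicSq m :=
  ![(Multiplicative.ofAdd 1, 1), (1, Multiplicative.ofAdd 1)]

/-- The exponents `![i, j]` (modulo `m`) of the element `σ ^ i * τ ^ j` of `C_m × C_m`. -/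
def exponents (x : CyclicSq m) : Fin 2 → ZMod m :=
  ![Multiplicative.toAdd x.1, Multiplicative.toAdd x.2]

lemma exponents_apply (φ : MulAut (CyclicSq m)) (x : CyclicSq m) (i : Fin 2) :
    exponents m (φ x) i = ∑ j, exponents m (φ (gen m j)) i * exponents m x j := by
  obtain ⟨a, b⟩ := x
  obtain ⟨a, rfl⟩ := Multiplicative.ofAdd.surjective a
  obtain ⟨b, rfl⟩ := Multiplicative.ofAdd.surjective b
  obtain ⟨a, rfl⟩ := ZMod.intCast_surjective a
  obtain ⟨b, rfl⟩ := ZMod.intCast_surjective b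
  have hx : ((Multiplicative.ofAdd (a : ZMod m), Multiplicative.ofAdd (b : ZMod m)) : CyclicSq m)
      = gen m 0 ^ a * gen m 1 ^ b := by
    ext <;> simp [gen, ← ofAdd_zsmul]
  have hexp : exponents m
      ((Multiplicative.ofAdd (a : ZMod m), Multiplicative.ofAdd (b : ZMod m)) : CyclicSq m)
      = ![(a : ZMod m), (b : ZMod m)] := rfl
  rw [hexp, hx, map_mul, map_zpow, map_zpow]
  fin_cases i <;> simp [exponents, Fin.sum_univ_two, mul_comm]

/-- The matrix `[φ]` of an automorphism `φ` of `C_m × C_m`: if `φ(σ) = σ^i₁ τ^j₁` and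
`φ(τ) = σ^i₂ τ^j₂`, then its columns are `(i₁, j₁)` and `(i₂, j₂)`. -/
def autMatrix : MulAut (CyclicSq m) →* Matrix (Fin 2) (Fin 2) (ZMod m) where
  toFun φ := Matrix.of fun i j => exponents m (φ (gen m j)) i
  map_one' := by
    ext i j
    fin_cases i <;> fin_cases j <;> simp [exponents, gen]
  map_mul' φ ψ := by
    ext i j
    simp only [Matrix.of_apply, Matrix.mul_apply, MulAut.mul_apply]
    exact exponents_apply m φ (ψ (gen m j)) i

/-- `SL₂(m)`: the automorphisms `φ` of `C_m × C_m` with `det [φ] = 1` modulo `m`. -/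
def SL2 : Subgroup (MulAut (CyclicSq m)) := (Matrix.detMonoidHom.comp (autMatrix m)).ker

end RankTwo

end CentralType

end

noncomputable section

namespace CentralType

/-! ### Twisted group algebras: universal property, regular trace, semisimplicity. -/

namespace TwistedGroupAlgebra

variable {G : Type u} [Group G] (f : twoCocycles G)

/-! The heart is a tensor decomposition (`exists_cocycle_nondegenerate_iff`). Let `F` be a cocycle
on `N ⋊ K` whose restriction to `N` is non-degenerate, so that the `u_n` span a copy of `M_a(ℂ)`. By
Skolem–Noether, conjugation by `u_k` on this copy is conjugation by some matrix `T_k`. The elements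
`v_k = T_k⁻¹ u_k` centralize the copy and span a twisted group algebra of `K`, so the whole algebra
is `M_a` of that algebra and is central exactly when the latter is. Multiplying `F` by the inflation
of a cocycle `γ` of `K` changes neither the copy nor the `T_k`; it only multiplies the cocycle `β`
of the `v_k` by `γ`.

Coprimality enters once in each direction. If `N ⋊ K` is of central type,
`IsNondegenerateCocycle.comap_of_coprime` shows by a count of idempotent traces that a
non-degenerate cocycle stays so on `N`; the decomposition then makes `β` non-degenerate on `K`, and
conjugation by `u_k` shows that the restricted class is `K`-invariant. Conversely, an invariant
class contains an invariant cocycle (`exists_invariant_cocycle`, averaging over `K`), which extends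
to `N ⋊ K`; the choice `γ = β⁻¹κ`, with `κ` non-degenerate on `K`, finishes.

For `C_m × C_m`, classes correspond to alternating bicharacters. Such a form is determined by its
value on `(σ, τ)`, of order `m` in the non-degenerate case, and an automorphism raises that value to
the power of its determinant. Hence invariance means determinant `1`. -/

instance [Finite G] : Module.Finite ℂ (TwistedGroupAlgebra f) := Module.Finite.of_basis (basis f)

instance : Nontrivial (TwistedGroupAlgebra f) := ⟨basis f 1, 0, (basis f).ne_zero 1⟩

lemma finrank_eq_card : Module.finrank ℂ (TwistedGroupAlgebra f) = Nat.card G :=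
  Module.finrank_eq_nat_card_basis (basis f)

lemma basis_mul_basis (g h : G) :
    basis f g * basis f h = (f.1 g h : ℂ) • basis f (g * h) := mulMap_basis f g h

lemma basis_one : basis f 1 = (f.1 1 1 : ℂ) • (1 : TwistedGroupAlgebra f) := by
  rw [one_def, smul_smul, ← Units.val_mul, mul_inv_cancel, Units.val_one, one_smul]

variable {f} in
/-- The algebra homomorphism `u_g ↦ x_g` attached to a family satisfying the relations of the
twisted group algebra. -/
def lift {R : Type*} [Ring R] [Algebra ℂ R] (x : G → R) (h1 : x 1 = (f.1 1 1 : ℂ) • (1 : R))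
    (hx : ∀ g h, x g * x h = (f.1 g h : ℂ) • x (g * h)) : TwistedGroupAlgebra f →ₐ[ℂ] R :=
  AlgHom.ofLinearMap ((basis f).constr ℂ x)
    (by
      rw [one_def, map_smul, Module.Basis.constr_basis, h1, smul_smul, ← Units.val_mul,
        inv_mul_cancel, Units.val_one, one_smul])
    (fun a b => by
      have : (LinearMap.mul ℂ (TwistedGroupAlgebra f)).compr₂ ((basis f).constr ℂ x) =
          (LinearMap.mul ℂ R).compl₁₂ ((basis f).constr ℂ x) ((basis f).constr ℂ x) := by
        refine (basis f).ext fun g => (basis f).ext fun h => ?_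
        simp [basis_mul_basis, hx]
      exact LinearMap.congr_fun₂ this a b)

@[simp]
lemma lift_basis {R : Type*} [Ring R] [Algebra ℂ R] (x : G → R)
    (h1 : x 1 = (f.1 1 1 : ℂ) • (1 : R))
    (hx : ∀ g h, x g * x h = (f.1 g h : ℂ) • x (g * h)) (g : G) :
    lift x h1 hx (basis f g) = x g :=
  (basis f).constr_basis ℂ x g

lemma isUnit_basis (g : G) : IsUnit (basis f g) := by
  have aux : ∀ g : G, IsUnit (basis f g * basis f g⁻¹) := fun g => by
    rw [basis_mul_basis, mul_inv_cancel, basis_one, smul_smul, ← Units.val_mul,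
      ← Algebra.algebraMap_eq_smul_one]
    exact (Units.isUnit _).map (algebraMap ℂ _)
  obtain ⟨b, hb⟩ := (aux g).exists_right_inv
  obtain ⟨c, hc⟩ := (aux g⁻¹).exists_left_inv
  rw [inv_inv] at hc
  exact isUnit_iff_exists_and_exists.2
    ⟨⟨_, (mul_assoc _ _ _).symm.trans hb⟩, ⟨_, (mul_assoc _ _ _).trans hc⟩⟩

lemma repr_mul_basis_one (x : TwistedGroupAlgebra f) (g h : G) :
    (basis f).repr (x * basis f g) (h * g) = (basis f).repr x h * f.1 h g := by
  have : (Finsupp.lapply (h * g) ∘ₗ (basis f).repr.toLinearMap) ∘ₗ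
        LinearMap.mulRight ℂ (basis f g) =
      (f.1 h g : ℂ) • (Finsupp.lapply h ∘ₗ (basis f).repr.toLinearMap) := by
    refine (basis f).ext fun k => ?_
    by_cases hk : k = h
    · subst hk; simp [basis_mul_basis]
    · simp [basis_mul_basis, hk]
  simpa [mul_comm] using LinearMap.congr_fun this x

/-- Only the `u_1` term of `x` contributes to the diagonal, equally at each basis vector. The
regular trace thus reads off the identity coefficient, both for Maschke and for comparing a group
with a subgroup. -/
lemma trace_mulLeft [Finite G] (x : TwistedGroupAlgebra f) :
    LinearMap.trace ℂ _ (LinearMap.mulLeft ℂ x) =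
      Nat.card G * (f.1 1 1 * (basis f).repr x 1) := by
  classical
  have := Fintype.ofFinite G
  rw [LinearMap.trace_eq_matrix_trace ℂ (basis f), Matrix.trace]
  have key : ∀ g, (LinearMap.toMatrix (basis f) (basis f) (LinearMap.mulLeft ℂ x)).diag g =
      f.1 1 1 * (basis f).repr x 1 := fun g => by
    have h := repr_mul_basis_one f x g 1
    rw [one_mul, cocycle_one_left] at h
    rw [Matrix.diag_apply, LinearMap.toMatrix_apply, LinearMap.mulLeft_apply, h, mul_comm]
  rw [Finset.sum_congr rfl fun g _ => key g]
  simp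

/-- **Maschke's theorem** for twisted group algebras. -/
instance [Finite G] : IsSemisimpleRing (TwistedGroupAlgebra f) := by
  have := IsArtinianRing.of_finite ℂ (TwistedGroupAlgebra f)
  rw [IsArtinianRing.isSemisimpleRing_iff_jacobson, eq_bot_iff]
  intro x hx
  obtain ⟨n, hn⟩ := IsSemiprimaryRing.isNilpotent (R := TwistedGroupAlgebra f)
  -- The radical is nilpotent, so its elements have regular trace zero and hence no identity
  -- coefficient; right multiplication by `u_{g⁻¹}` then reaches the coefficient at `g`.
  have key : ∀ y ∈ Ring.jacobson (TwistedGroupAlgebra f), (basis f).repr y 1 = 0 := by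
    intro y hy
    have hnil : IsNilpotent (LinearMap.mulLeft ℂ y) := by
      refine ⟨n, ?_⟩
      rw [LinearMap.pow_mulLeft]
      have : y ^ n = 0 := by
        have := Ideal.pow_mem_pow hy n
        rwa [hn] at this
      rw [this, LinearMap.mulLeft_zero_eq_zero]
    have := (LinearMap.isNilpotent_trace_of_isNilpotent hnil).eq_zero
    rw [trace_mulLeft] at this
    simpa [Nat.card_pos.ne'] using this
  rw [Submodule.mem_bot]
  refine (basis f).ext_elem fun g => ?_
  have h := repr_mul_basis_one f x g⁻¹ g
  rw [mul_inv_cancel, key _ (Ideal.mul_mem_right _ _ hx)] at h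
  simpa using h.symm

end TwistedGroupAlgebra

/-! ### Traces of idempotents and transport along algebra isomorphisms. -/

lemma trace_mulLeft_matrix {n : Type*} [Fintype n] [DecidableEq n] (x : Matrix n n ℂ) :
    LinearMap.trace ℂ _ (LinearMap.mulLeft ℂ x) = Fintype.card n * x.trace := by
  rw [LinearMap.trace_eq_matrix_trace ℂ (Matrix.stdBasis ℂ n n), Matrix.trace]
  have key : ∀ p : n × n, (LinearMap.toMatrix (Matrix.stdBasis ℂ n n) (Matrix.stdBasis ℂ n n)
      (LinearMap.mulLeft ℂ x)).diag p = x p.1 p.1 := fun p => by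
    rw [Matrix.diag_apply, LinearMap.toMatrix_apply, LinearMap.mulLeft_apply,
      Matrix.stdBasis_eq_single]
    change (x * Matrix.single p.1 p.2 (1 : ℂ) : Matrix n n ℂ) p.1 p.2 = _
    simp
  rw [Finset.sum_congr rfl fun p _ => key p, Fintype.sum_prod_type]
  simp [Matrix.trace, Finset.mul_sum]

lemma trace_mulLeft_algEquiv {A B : Type*} [Ring A] [Ring B] [Algebra ℂ A] [Algebra ℂ B]
    (e : A ≃ₐ[ℂ] B) (x : A) :
    LinearMap.trace ℂ _ (LinearMap.mulLeft ℂ (e x)) =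
      LinearMap.trace ℂ _ (LinearMap.mulLeft ℂ x) := by
  rw [← LinearMap.trace_conj' (LinearMap.mulLeft ℂ x) e.toLinearEquiv]
  congr 1
  ext b
  simp [LinearEquiv.conj_apply]

lemma trace_eq_finrank_range {V : Type*} [AddCommGroup V] [Module ℂ V] [Module.Finite ℂ V]
    {p : V →ₗ[ℂ] V} (hp : IsIdempotentElem p) :
    LinearMap.trace ℂ V p = Module.finrank ℂ (LinearMap.range p) :=
  (LinearMap.IsIdempotentElem.isProj_range p hp).trace

lemma isIdempotentElem_mulLeft {A : Type*} [Ring A] [Algebra ℂ A] {x : A}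
    (hx : IsIdempotentElem x) : IsIdempotentElem (LinearMap.mulLeft ℂ x) := by
  change LinearMap.mulLeft ℂ x ∘ₗ LinearMap.mulLeft ℂ x = _
  rw [← LinearMap.mulLeft_mul, hx.eq]

lemma isCentral_of_algEquiv {A B : Type*} [Ring A] [Ring B] [Algebra ℂ A] [Algebra ℂ B]
    (e : A ≃ₐ[ℂ] B) [h : Algebra.IsCentral ℂ B] : Algebra.IsCentral ℂ A where
  out x hx := by
    have hex : e x ∈ Subalgebra.center ℂ B := by
      rw [Subalgebra.mem_center_iff] at hx ⊢
      intro b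
      rw [← e.apply_symm_apply b, ← map_mul, ← map_mul, hx]
    obtain ⟨r, hr⟩ := Algebra.mem_bot.1 (h.out hex)
    exact Algebra.mem_bot.2 ⟨r, e.injective (by rw [← hr, AlgEquiv.commutes])⟩

lemma sq_eq_card {G : Type u} [Group G] {f : twoCocycles G} {ι : Type*} [Fintype ι] [DecidableEq ι]
    (e : TwistedGroupAlgebra f ≃ₐ[ℂ] Matrix ι ι ℂ) : Fintype.card ι ^ 2 = Nat.card G := by
  rw [← TwistedGroupAlgebra.finrank_eq_card f, e.toLinearEquiv.finrank_eq, Module.finrank_matrix]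
  simp [sq]

/-! ### Criteria for non-degeneracy. -/

section Criteria

variable {G : Type u} [Group G] [Finite G] {f : twoCocycles G}

/-- A surjection onto a matrix algebra whose size is at least the order of `G` witnesses
non-degeneracy. -/
lemma isNondegenerateCocycle_of_surjective {d : ℕ}
    (φ : TwistedGroupAlgebra f →ₐ[ℂ] Matrix (Fin d) (Fin d) ℂ) (hφ : Function.Surjective φ)
    (hd : Nat.card G ≤ d ^ 2) : IsNondegenerateCocycle f := by
  have h1 : Module.finrank ℂ (TwistedGroupAlgebra f) =
      Module.finrank ℂ (Matrix (Fin d) (Fin d) ℂ) := by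
    refine le_antisymm ?_ (LinearMap.finrank_le_finrank_of_surjective (f := φ.toLinearMap) hφ)
    rw [TwistedGroupAlgebra.finrank_eq_card, Module.finrank_matrix]
    simpa [sq] using hd
  exact ⟨d, ⟨AlgEquiv.ofBijective φ
    ⟨(LinearMap.injective_iff_surjective_of_finrank_eq_finrank (f := φ.toLinearMap) h1).2 hφ,
      hφ⟩⟩⟩

/-- A cocycle is non-degenerate if and only if its twisted group algebra is central. -/
lemma isNondegenerateCocycle_iff_isCentral :
    IsNondegenerateCocycle f ↔ Algebra.IsCentral ℂ (TwistedGroupAlgebra f) := by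
  constructor
  · rintro ⟨n, ⟨e⟩⟩
    exact isCentral_of_algEquiv e
  · intro h
    obtain ⟨n, d, hd, ⟨e⟩⟩ := IsSemisimpleRing.exists_algEquiv_pi_matrix_of_isAlgClosed ℂ
      (TwistedGroupAlgebra f)
    have hc : Algebra.IsCentral ℂ (∀ i, Matrix (Fin (d i)) (Fin (d i)) ℂ) :=
      isCentral_of_algEquiv e.symm
    -- With two Wedderburn blocks, the unit of one block would be a central non-scalar element.
    have hsub : Subsingleton (Fin n) := ⟨fun i j => by
      by_contra hij
      have hz : (Pi.single i 1 : ∀ i, Matrix (Fin (d i)) (Fin (d i)) ℂ) ∈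
          Subalgebra.center ℂ (∀ i, Matrix (Fin (d i)) (Fin (d i)) ℂ) := by
        rw [Subalgebra.mem_center_iff]
        intro b
        ext1 k
        by_cases hk : k = i
        · subst hk; simp
        · simp [Pi.single_eq_of_ne hk]
      obtain ⟨r, hr⟩ := Algebra.mem_bot.1 (hc.out hz)
      have hj := congrFun hr j
      rw [Pi.single_eq_of_ne (Ne.symm hij), Pi.algebraMap_apply] at hj
      have hr0 : r = 0 := (map_eq_zero _).1 hj
      have hi := congrFun hr i
      rw [Pi.single_eq_same, hr0, map_zero] at hi
      exact zero_ne_one hi⟩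
    have hne : Nonempty (Fin n) := by
      by_contra hn
      rw [not_nonempty_iff] at hn
      exact zero_ne_one (e.injective (Subsingleton.elim (e 0) (e 1)))
    obtain ⟨i⟩ := hne
    have hbij : Function.Bijective
        ((Pi.evalAlgHom ℂ (fun i => Matrix (Fin (d i)) (Fin (d i)) ℂ) i).comp e.toAlgHom) := by
      refine Function.Bijective.comp (g := fun x : ∀ i, Matrix (Fin (d i)) (Fin (d i)) ℂ => x i)
        ⟨fun x y hxy => funext fun j => ?_, fun y => ⟨Pi.single i y, Pi.single_eq_same _ _⟩⟩
        e.bijective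
      rw [Subsingleton.elim j i]; exact hxy
    exact ⟨d i, ⟨AlgEquiv.ofBijective _ hbij⟩⟩

end Criteria

/-! ### Restriction to Hall subgroups. -/

section Comap

variable {G : Type u} {H : Type v} [Group G] [Group H]

/-- Pullback of 2-cocycles along a group homomorphism. -/
def comapCocycle (i : H →* G) : twoCocycles G →* twoCocycles H where
  toFun f := ⟨fun g h => f.1 (i g) (i h), fun g h k => by
    simp only [map_mul]
    exact f.2 _ _ _⟩
  map_one' := rfl
  map_mul' _ _ := rfl

lemma comapCocycle_apply (i : H →* G) (f : twoCocycles G) (g h : H) :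
    (comapCocycle i f).1 g h = f.1 (i g) (i h) := rfl

/-- The homomorphism of twisted group algebras induced by a group homomorphism. -/
def mapAlgHom (i : H →* G) (f : twoCocycles G) :
    TwistedGroupAlgebra (comapCocycle i f) →ₐ[ℂ] TwistedGroupAlgebra f :=
  TwistedGroupAlgebra.lift (fun h => TwistedGroupAlgebra.basis f (i h))
    (by rw [map_one, TwistedGroupAlgebra.basis_one, comapCocycle_apply, map_one])
    (fun g h => by rw [TwistedGroupAlgebra.basis_mul_basis, ← map_mul i]; rfl)

/-- By injectivity only `1` maps to `1`. This links the regular traces of an element over `H` and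
over `G`. -/
lemma repr_mapAlgHom_one {i : H →* G} (hi : Function.Injective i) (f : twoCocycles G)
    (x : TwistedGroupAlgebra (comapCocycle i f)) :
    (TwistedGroupAlgebra.basis f).repr (mapAlgHom i f x) 1 =
      (TwistedGroupAlgebra.basis (comapCocycle i f)).repr x 1 := by
  have : Finsupp.lapply 1 ∘ₗ (TwistedGroupAlgebra.basis f).repr.toLinearMap ∘ₗ
        (mapAlgHom i f).toLinearMap =
      Finsupp.lapply 1 ∘ₗ (TwistedGroupAlgebra.basis (comapCocycle i f)).repr.toLinearMap := by
    refine (TwistedGroupAlgebra.basis _).ext fun h => ?_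
    by_cases hh : h = 1
    · subst hh; simp [mapAlgHom]
    · simp [mapAlgHom, hh, (map_ne_one_iff i hi).2 hh]
  exact LinearMap.congr_fun this x

/-- A non-degenerate cocycle restricts to a non-degenerate cocycle on a Hall subgroup. -/
lemma IsNondegenerateCocycle.comap_of_coprime [Finite G] {i : H →* G} (hi : Function.Injective i)
    {k : ℕ} (hk : Nat.card G = Nat.card H * k) (hcop : (Nat.card H).Coprime k)
    {f : twoCocycles G} (hf : IsNondegenerateCocycle f) :
    IsNondegenerateCocycle (comapCocycle i f) := by
  have : Finite H := Finite.of_injective i hi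
  obtain ⟨n, ⟨e⟩⟩ := hf
  obtain ⟨s, d, hd, ⟨w⟩⟩ := IsSemisimpleRing.exists_algEquiv_pi_matrix_of_isAlgClosed ℂ
    (TwistedGroupAlgebra (comapCocycle i f))
  have hne : Nonempty (Fin s) := by
    by_contra hn
    rw [not_nonempty_iff] at hn
    exact zero_ne_one (w.injective (Subsingleton.elim (w 0) (w 1)))
  obtain ⟨j⟩ := hne
  have := hd j
  -- a primitive idempotent of the block `j`
  set p : ∀ i, Matrix (Fin (d i)) (Fin (d i)) ℂ := Pi.single j (Matrix.single 0 0 1) with hp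
  have hpi : IsIdempotentElem p := by
    rw [IsIdempotentElem, hp, ← Pi.single_mul]
    simp
  have hp0 : p ≠ 0 := by
    rw [hp, Ne, Pi.single_eq_zero_iff]
    intro h
    simpa using congrFun (congrFun h 0) 0
  set x := w.symm p with hx
  have hxi : IsIdempotentElem x := hpi.map w.symm
  set D := Module.finrank ℂ (LinearMap.range (LinearMap.mulLeft ℂ p)) with hD
  have hDpos : 0 < D := by
    have : Nontrivial (LinearMap.range (LinearMap.mulLeft ℂ p)) :=
      ⟨⟨p, 1, by simp⟩, 0, fun h => hp0 (congrArg Subtype.val h)⟩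
    exact Module.finrank_pos
  -- Left multiplication by `p` keeps only row `0` of block `j`, which has `d j` entries.
  have hDle : D ≤ d j := by
    have hle : LinearMap.range (LinearMap.mulLeft ℂ p) ≤ LinearMap.range
        ((LinearMap.single ℂ (fun i => Matrix (Fin (d i)) (Fin (d i)) ℂ) j) ∘ₗ
          (Matrix.ofLinearEquiv ℂ).toLinearMap ∘ₗ
            (LinearMap.single ℂ (fun _ : Fin (d j) => Fin (d j) → ℂ) 0)) := by
      rintro _ ⟨y, rfl⟩
      refine ⟨y j 0, ?_⟩
      change Pi.single j (Matrix.of (Pi.single 0 (y j 0))) = p * y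
      ext k a b
      by_cases hkj : k = j
      · subst hkj
        by_cases ha : a = 0
        · subst ha; simp [hp]
        · simp [hp, ha]
      · simp [hp, Pi.single_eq_of_ne hkj]
    refine (Submodule.finrank_mono hle).trans ((LinearMap.finrank_range_le _).trans ?_)
    simp
  have h1 : (D : ℂ) = Nat.card H * (f.1 1 1 *
      (TwistedGroupAlgebra.basis (comapCocycle i f)).repr x 1) := by
    have h := TwistedGroupAlgebra.trace_mulLeft (comapCocycle i f) x
    rw [comapCocycle_apply, map_one, ← trace_mulLeft_algEquiv w, hx, w.apply_symm_apply,
      trace_eq_finrank_range (isIdempotentElem_mulLeft hpi)] at h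
    exact h
  set y := mapAlgHom i f x
  have hyi : IsIdempotentElem (e y) := (hxi.map (mapAlgHom i f)).map e
  obtain ⟨r, hr⟩ : ∃ r : ℕ, (e y).trace = r := by
    refine ⟨Module.finrank ℂ (LinearMap.range (Matrix.toLin' (e y))), ?_⟩
    exact (Matrix.trace_toLin'_eq _).symm.trans
      (trace_eq_finrank_range (hyi.map Matrix.toLinAlgEquiv'))
  have h2 : (n : ℂ) * r = Nat.card G * (f.1 1 1 *
      (TwistedGroupAlgebra.basis (comapCocycle i f)).repr x 1) := by
    have h := TwistedGroupAlgebra.trace_mulLeft f y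
    rw [← trace_mulLeft_algEquiv e, trace_mulLeft_matrix, hr, repr_mapAlgHom_one hi] at h
    simpa using h
  -- The same identity coefficient gives regular trace `D` over `H` and `n * r` over `G`, where `r`
  -- is the rank of the image idempotent; the ratio is the index `k`.
  have h3 : n * r = k * D := by
    have : (n : ℂ) * r = k * D := by rw [h2, h1, hk]; push_cast; ring
    exact_mod_cast this
  have hn : n ^ 2 = Nat.card H * k := by rw [← hk, ← sq_eq_card e, Fintype.card_fin]
  have hkpos : 0 < k := Nat.pos_of_ne_zero fun h => Nat.card_pos.ne' (hk.trans (by rw [h, mul_zero]))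
  -- Squaring and using `n² = |H| k` puts `|H|` as a divisor of `k D²`, hence of `D²` by
  -- coprimality. So `|H| ≤ (d j)²` and block `j` is the whole algebra.
  have h4 : Nat.card H * r ^ 2 = k * D ^ 2 := by
    refine Nat.eq_of_mul_eq_mul_left hkpos ?_
    calc k * (Nat.card H * r ^ 2) = (n * r) ^ 2 := by rw [mul_pow, hn]; ring
      _ = _ := by rw [h3]; ring
  have h5 : Nat.card H ≤ D ^ 2 :=
    Nat.le_of_dvd (pow_pos hDpos 2) (hcop.dvd_of_dvd_mul_left ⟨_, h4.symm⟩)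
  exact isNondegenerateCocycle_of_surjective
    ((Pi.evalAlgHom ℂ (fun i => Matrix (Fin (d i)) (Fin (d i)) ℂ) j).comp w.toAlgHom)
    (fun m => ⟨w.symm (Pi.single j m), by simp⟩)
    (h5.trans (Nat.pow_le_pow_left hDle 2))

end Comap

/-! ### Cohomology classes and invariance under coprime actions. -/

section Classes

variable {G : Type u} [Group G]

lemma H2.mk_surjective : Function.Surjective (H2.mk G) := QuotientGroup.mk'_surjective _

lemma H2.mk_eq_mk_iff {f f' : twoCocycles G} :
    H2.mk G f = H2.mk G f' ↔ ∃ c : G → ℂˣ, f * coboundary G c = f' :=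
  (QuotientGroup.mk'_eq_mk' _).trans
    ⟨fun ⟨_, ⟨c, hc⟩, h⟩ => ⟨c, hc ▸ h⟩, fun ⟨c, h⟩ => ⟨_, ⟨c, rfl⟩, h⟩⟩

lemma coboundary_apply (c : G → ℂˣ) (g h : G) :
    (coboundary G c).1 g h = c g * c h * (c (g * h))⁻¹ := rfl

lemma mul_coboundary_apply (f : twoCocycles G) (c : G → ℂˣ) (g h : G) :
    (f * coboundary G c).1 g h = f.1 g h * (c g * c h * (c (g * h))⁻¹) := rfl

lemma smul_mk (φ : MulAut G) (f : twoCocycles G) :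
    φ • H2.mk G f = H2.mk G (autCocycle φ f) := rfl

lemma autCocycle_apply (φ : MulAut G) (f : twoCocycles G) (g h : G) :
    (autCocycle φ f).1 g h = f.1 (φ⁻¹ g) (φ⁻¹ h) := rfl

lemma autCocycle_mul (φ ψ : MulAut G) (f : twoCocycles G) :
    autCocycle (φ * ψ) f = autCocycle φ (autCocycle ψ f) := by
  ext g h
  simp only [autCocycle_apply, mul_inv_rev, MulAut.mul_apply]

/-- Rescaling `u_g` by `c(g)` absorbs the coboundary, so non-degeneracy can be tested on any
representative of a class. -/
lemma IsNondegenerateCocycle.of_mk_eq [Finite G] {f f' : twoCocycles G}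
    (hf : IsNondegenerateCocycle f) (h : H2.mk G f = H2.mk G f') :
    IsNondegenerateCocycle f' := by
  obtain ⟨n, ⟨e⟩⟩ := hf
  obtain ⟨c, rfl⟩ := H2.mk_eq_mk_iff.1 h
  have hc : ∀ g, (c g : ℂ) ≠ 0 := fun g => (c g).ne_zero
  let φ : TwistedGroupAlgebra (f * coboundary G c) →ₐ[ℂ] TwistedGroupAlgebra f :=
    TwistedGroupAlgebra.lift (fun g => (c g : ℂ) • TwistedGroupAlgebra.basis f g)
      (by rw [TwistedGroupAlgebra.basis_one, smul_smul, mul_coboundary_apply]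
          simp [mul_comm])
      (fun g h => by
        rw [smul_mul_smul_comm, TwistedGroupAlgebra.basis_mul_basis, smul_smul, smul_smul,
          mul_coboundary_apply]
        congr 1
        push_cast
        field_simp [hc])
  have hφ : Function.Surjective φ := by
    rw [← AlgHom.coe_toLinearMap, ← LinearMap.range_eq_top, eq_top_iff,
      ← (TwistedGroupAlgebra.basis f).span_eq, Submodule.span_le]
    rintro _ ⟨g, rfl⟩
    refine ⟨(c g : ℂ)⁻¹ • TwistedGroupAlgebra.basis _ g, ?_⟩
    simp [φ, smul_smul, hc]
  refine isNondegenerateCocycle_of_surjective (e.toAlgHom.comp φ) (e.surjective.comp hφ) ?_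
  rw [← sq_eq_card e, Fintype.card_fin]

lemma IsNondegenerate.isNondegenerateCocycle [Finite G] {f : twoCocycles G}
    (h : IsNondegenerate (H2.mk G f)) : IsNondegenerateCocycle f := by
  obtain ⟨f', h1, h2⟩ := h
  exact h2.of_mk_eq h1

/-- `H²(G, ℂˣ)` is annihilated by the order of `G`. -/
lemma H2.pow_card [Finite G] (c : H2 G) : c ^ Nat.card G = 1 := by
  have := Fintype.ofFinite G
  obtain ⟨f, rfl⟩ := H2.mk_surjective c
  rw [← map_pow, ← map_one (H2.mk G), eq_comm, H2.mk_eq_mk_iff]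
  -- Take the product of the cocycle identity for `(g, h, x)` over all `x`.
  refine ⟨fun g => ∏ x, f.1 g x, ?_⟩
  rw [one_mul]
  ext1
  funext g h
  have key : f.1 g h ^ Nat.card G * ∏ x, f.1 (g * h) x = (∏ x, f.1 h x) * ∏ x, f.1 g x := by
    rw [← Equiv.prod_comp (Equiv.mulLeft h) (fun x => f.1 g x), ← Finset.prod_mul_distrib,
      Nat.card_eq_fintype_card, ← Finset.card_univ, ← Finset.prod_const, ← Finset.prod_mul_distrib]
    exact Finset.prod_congr rfl fun x _ => f.2 g h x
  change (∏ x, f.1 g x) * (∏ x, f.1 h x) * (∏ x, f.1 (g * h) x)⁻¹ = f.1 g h ^ Nat.card G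
  rw [mul_inv_eq_iff_eq_mul, key, mul_comm]

/-- A class invariant under a coprime action contains an invariant cocycle. -/
lemma exists_invariant_cocycle [Finite G] {K : Type v} [Group K] [Finite K] (η : K →* MulAut G)
    (hcop : (Nat.card G).Coprime (Nat.card K)) (c : H2 G) (hc : η.range ≤ symplecticGroup c) :
    ∃ f : twoCocycles G, H2.mk G f = c ∧ ∀ k, autCocycle (η k) f = f := by
  have := Fintype.ofFinite K
  obtain ⟨f, rfl⟩ := H2.mk_surjective c
  have hk : ∀ k, H2.mk G (autCocycle (η k) f) = H2.mk G f := fun k => hc ⟨k, rfl⟩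
  -- The product of the `K`-translates of `f` is invariant but has class `c ^ |K|`; an inverse `r`
  -- of `|K|` modulo `|G|` recovers `c`, since `|G|` annihilates `c`.
  obtain ⟨r, -, hr⟩ := Nat.exists_mul_mod_eq_of_coprime 1 hcop.symm Nat.card_pos.ne'
  refine ⟨(∏ k, autCocycle (η k) f) ^ r, ?_, fun l => ?_⟩
  · rw [map_pow, map_prod, Finset.prod_congr rfl fun k _ => hk k, Finset.prod_const,
      Finset.card_univ, ← Nat.card_eq_fintype_card, ← pow_mul,
      pow_eq_pow_mod _ (H2.pow_card (H2.mk G f)), hr, ← pow_eq_pow_mod _ (H2.pow_card _), pow_one]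
  · rw [map_pow, map_prod]
    congr 1
    simp only [← autCocycle_mul, ← map_mul]
    exact Equiv.prod_comp (Equiv.mulLeft l) fun k => autCocycle (η k) f

end Classes

/-! ### Scalars arising from conjugation in a twisted group algebra. -/

section Conjugation

variable {G : Type u} [Group G] (f : twoCocycles G)

/-- The scalar `f(g, n) / f(x, g)`; if `g n = x g` then `u_g u_n u_g⁻¹` is this multiple
of `u_x`. -/
def conjScalar (g n x : G) : ℂˣ := f.1 g n * (f.1 x g)⁻¹

variable {f}

/-- Conjugation by `u_g` is multiplicative: compare its effect on `u_n u_m` factor by factor and all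
at once. -/
lemma conjScalar_mul {g n m x y : G} (hx : g * n = x * g) (hy : g * m = y * g) :
    conjScalar f g n x * conjScalar f g m y * f.1 x y =
      f.1 n m * conjScalar f g (n * m) (x * y) := by
  have h1 := f.2 g n m
  have h2 := f.2 x y g
  have h3 := f.2 x g m
  rw [hx] at h1
  rw [hy] at h3
  simp only [conjScalar]
  rw [← mul_left_inj (f.1 x g * f.1 y g * f.1 (x * y) g)]
  simp only [Units.ext_iff, Units.val_mul, Units.val_inv_eq_inv_val] at *
  field_simp
  linear_combination (f.1 g n * f.1 g m : ℂ) * h2 - (f.1 g n * f.1 y g : ℂ) * h3 +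
    (f.1 x g * f.1 y g : ℂ) * h1

/-- Conjugation by `u_g u_h` equals conjugation by `u_{gh}`, because the scalar `f(g, h)` cancels.
-/
lemma conjScalar_comp {g h n x y : G} (hx : h * n = x * h) (hy : g * x = y * g) :
    conjScalar f g x y * conjScalar f h n x = conjScalar f (g * h) n y := by
  have h1 := f.2 g h n
  have h2 := f.2 g x h
  have h3 := f.2 y g h
  rw [hx] at h1
  rw [hy] at h2
  simp only [conjScalar]
  simp only [Units.ext_iff, Units.val_mul, Units.val_inv_eq_inv_val] at *
  field_simp
  refine mul_left_cancel₀ (f.1 g h).ne_zero ?_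
  linear_combination (-f.1 g x * f.1 h n : ℂ) * h3 + (f.1 h n * f.1 y g : ℂ) * h2 -
    (f.1 y g * f.1 x h : ℂ) * h1

/-- Both sides are the coefficient of `u_n u_k u_m u_l`, computed as `(u_n u_k)(u_m u_l)` and after
moving `u_m` to the left of `u_k`. -/
lemma cocycle_mul_mul {n k m l x : G} (hx : k * m = x * k) :
    f.1 n k * f.1 m l * f.1 (n * k) (m * l) =
      conjScalar f k m x * f.1 n x * f.1 k l * f.1 (n * x) (k * l) := by
  have h1 := f.2 n k (m * l)
  have h2 := f.2 k m l
  have h3 := f.2 x k l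
  have h4 := f.2 n x (k * l)
  rw [← mul_assoc k m l, hx, mul_assoc x k l] at h1
  rw [hx] at h2
  simp only [conjScalar]
  simp only [Units.ext_iff, Units.val_mul, Units.val_inv_eq_inv_val] at *
  field_simp
  linear_combination (f.1 m l * f.1 x k : ℂ) * h1 - (f.1 x k * f.1 n (x * (k * l)) : ℂ) * h2 +
    (f.1 k m * f.1 n (x * (k * l)) : ℂ) * h3 - (f.1 k m * f.1 k l : ℂ) * h4

end Conjugation

/-! ### Skolem–Noether and matrices over an algebra. -/

section MatrixAlgebra

variable {ι : Type*}

/-- A form of the **Skolem–Noether theorem**. -/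
lemma exists_unit_conj [Fintype ι] [DecidableEq ι] (φ : Matrix ι ι ℂ →ₐ[ℂ] Matrix ι ι ℂ) :
    ∃ T : (Matrix ι ι ℂ)ˣ, ∀ x, T * x = φ x * T := by
  rcases isEmpty_or_nonempty ι with h | h
  · exact ⟨1, fun x => Subsingleton.elim _ _⟩
  let ψ := AlgEquiv.ofBijective φ φ.bijective
  obtain ⟨T, hT⟩ := ((Matrix.toLinAlgEquiv'.symm.trans ψ).trans
    Matrix.toLinAlgEquiv').eq_linearEquivConjAlgEquiv
  let e : Module.End ℂ (ι → ℂ) ≃ₐ[ℂ] Matrix ι ι ℂ := Matrix.toLinAlgEquiv'.symm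
  have h1 : T.toLinearMap * T.symm.toLinearMap = 1 := LinearMap.ext fun v => T.apply_symm_apply v
  have h2 : T.symm.toLinearMap * T.toLinearMap = 1 := LinearMap.ext fun v => T.symm_apply_apply v
  refine ⟨⟨e T.toLinearMap, e T.symm.toLinearMap, ?_, ?_⟩, fun x => ?_⟩
  · rw [← map_mul, h1, map_one]
  · rw [← map_mul, h2, map_one]
  · have h : e.symm (φ (e (e.symm x))) * T.toLinearMap = T.toLinearMap * e.symm x := by
      have := AlgEquiv.congr_fun hT (e.symm x)
      change e.symm (φ (e (e.symm x))) = T.toLinearMap * e.symm x * T.symm.toLinearMap at this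
      rw [this, mul_assoc, h2, mul_one]
    rw [e.apply_symm_apply] at h
    have h' := congrArg e h
    rw [map_mul, map_mul, e.apply_symm_apply, e.apply_symm_apply] at h'
    exact h'.symm

/-- The elementary tensor `M ⊗ b`, as a matrix with entries in `B`. -/
def tmulMatrix {B : Type*} [Ring B] [Algebra ℂ B] : Matrix ι ι ℂ →ₗ[ℂ] B →ₗ[ℂ] Matrix ι ι B :=
  LinearMap.mk₂ ℂ (fun M b => M.map (· • b))
    (fun _ _ _ => by ext; simp [add_smul]) (fun _ _ _ => by ext; simp [mul_smul])
    (fun _ _ _ => by ext; simp) (fun _ _ _ => by ext; exact smul_comm _ _ _)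

variable {B : Type*} [Ring B] [Algebra ℂ B]

lemma tmulMatrix_apply (M : Matrix ι ι ℂ) (b : B) (i j : ι) :
    tmulMatrix M b i j = M i j • b := rfl

lemma tmulMatrix_mul [Fintype ι] (M M' : Matrix ι ι ℂ) (b b' : B) :
    tmulMatrix M b * tmulMatrix M' b' = tmulMatrix (M * M') (b * b') := by
  ext i j
  simp only [Matrix.mul_apply, tmulMatrix_apply, Finset.sum_smul, smul_mul_smul_comm]

lemma tmulMatrix_one [DecidableEq ι] : tmulMatrix (1 : Matrix ι ι ℂ) (1 : B) = 1 := by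
  ext i j
  by_cases h : i = j <;> simp [tmulMatrix_apply, Matrix.one_apply, h]

/-- The scalar matrix of a central element of `B` is central; a diagonal entry brings the conclusion
back to `B`. -/
lemma isCentral_of_matrix [Fintype ι] [DecidableEq ι] [Nonempty ι] [h : Algebra.IsCentral ℂ (Matrix ι ι B)] :
    Algebra.IsCentral ℂ B where
  out z hz := by
    have hs : Matrix.scalar ι z ∈ Subalgebra.center ℂ (Matrix ι ι B) := by
      rw [Subalgebra.mem_center_iff] at hz ⊢
      intro M
      exact ((Matrix.scalar_commute z (fun b => (hz b).symm) M).eq).symm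
    obtain ⟨r, hr⟩ := Algebra.mem_bot.1 (h.out hs)
    obtain ⟨i⟩ := ‹Nonempty ι›
    refine Algebra.mem_bot.2 ⟨r, ?_⟩
    simpa [Matrix.algebraMap_matrix_apply] using congrFun (congrFun hr i) i

end MatrixAlgebra

/-! ### The tensor decomposition over a semidirect product. -/

lemma isNondegenerateCocycle_iff_of_algEquiv {G : Type u} {K : Type v} [Group G] [Group K]
    [Finite G] [Finite K] {f : twoCocycles G} {δ : twoCocycles K} {a : ℕ} [NeZero a]
    (e : TwistedGroupAlgebra f ≃ₐ[ℂ] Matrix (Fin a) (Fin a) (TwistedGroupAlgebra δ)) :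
    IsNondegenerateCocycle f ↔ IsNondegenerateCocycle δ := by
  constructor
  · intro h
    have := isNondegenerateCocycle_iff_isCentral.1 h
    have := isCentral_of_algEquiv e.symm
    exact isNondegenerateCocycle_iff_isCentral.2 (isCentral_of_matrix (ι := Fin a))
  · rintro ⟨b, ⟨e'⟩⟩
    exact ⟨a * b, ⟨((e.trans e'.mapMatrix).trans (Matrix.compAlgEquiv (Fin a) (Fin b) ℂ ℂ)).trans
      (Matrix.reindexAlgEquiv ℂ ℂ finProdFinEquiv)⟩⟩

lemma inr_mul_inl {N : Type u} {K : Type v} [Group N] [Group K] {η : K →* MulAut N} (k : K)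
    (n : N) : (SemidirectProduct.inr k : N ⋊[η] K) * SemidirectProduct.inl n =
      SemidirectProduct.inl (η k n) * SemidirectProduct.inr k := by
  rw [SemidirectProduct.inl_aut, map_inv, inv_mul_cancel_right]

open TwistedGroupAlgebra in
/-- If `ρ` identifies the twisted group algebra of `N` with a matrix algebra, then the conjugation
action of `k` on it is inner, given by an invertible matrix `T_k`. -/
lemma exists_conj_units {N : Type u} {K : Type v} [Group N] [Group K] {η : K →* MulAut N}
    (F : twoCocycles (N ⋊[η] K)) {a : ℕ}
    (ρ : TwistedGroupAlgebra (comapCocycle (SemidirectProduct.inl : N →* N ⋊[η] K) F) ≃ₐ[ℂ]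
      Matrix (Fin a) (Fin a) ℂ) (k : K) :
    ∃ T : (Matrix (Fin a) (Fin a) ℂ)ˣ, ∀ n : N, (T : Matrix (Fin a) (Fin a) ℂ) * ρ (basis _ n) =
      (conjScalar F (.inr k) (.inl n) (.inl (η k n)) : ℂ) • (ρ (basis _ (η k n)) * T) := by
  -- This is `u_n ↦ u_k u_n u_k⁻¹` followed by `ρ`; composed with `ρ⁻¹` it is an endomorphism of the
  -- matrix algebra.
  let φ : TwistedGroupAlgebra (comapCocycle (SemidirectProduct.inl : N →* N ⋊[η] K) F) →ₐ[ℂ]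
      Matrix (Fin a) (Fin a) ℂ :=
    lift (fun n => (conjScalar F (.inr k) (.inl n) (.inl (η k n)) : ℂ) • ρ (basis _ (η k n)))
      (by
        rw [map_one (η k), map_one SemidirectProduct.inl, basis_one, map_smul, map_one ρ, smul_smul]
        simp [conjScalar, cocycle_one_left, cocycle_one_right])
      (fun n m => by
        rw [smul_mul_smul_comm, ← map_mul ρ, basis_mul_basis, map_smul, smul_smul, smul_smul,
          ← map_mul (η k)]
        congr 1
        have h := conjScalar_mul (f := F) (inr_mul_inl k n) (inr_mul_inl k m)
        rw [← map_mul, ← map_mul, ← map_mul (η k)] at h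
        exact_mod_cast congrArg Units.val h)
  obtain ⟨T, hT⟩ := exists_unit_conj (φ.comp ρ.symm.toAlgHom)
  refine ⟨T, fun n => ?_⟩
  rw [hT, ← smul_mul_assoc]
  congr 1
  have : (φ.comp ρ.symm.toAlgHom) (ρ (basis _ n)) = φ (basis _ n) :=
    congrArg φ (ρ.symm_apply_apply _)
  rw [this]
  simp only [φ, lift_basis]

open TwistedGroupAlgebra in
/-- The twisted group algebra of `N ⋊ K` over a cocycle which is non-degenerate on `N` is a matrix
algebra over a twisted group algebra of `K`. -/
theorem exists_cocycle_nondegenerate_iff {N : Type u} {K : Type v} [Group N] [Group K] [Finite N]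
    [Finite K] {η : K →* MulAut N} (F : twoCocycles (N ⋊[η] K))
    (hF : IsNondegenerateCocycle (comapCocycle (SemidirectProduct.inl : N →* N ⋊[η] K) F)) :
    ∃ β : twoCocycles K, ∀ γ : twoCocycles K,
      IsNondegenerateCocycle (F * comapCocycle SemidirectProduct.rightHom γ) ↔
        IsNondegenerateCocycle (β * γ) := by
  obtain ⟨a, ⟨ρ⟩⟩ := hF
  have : Finite (N ⋊[η] K) := Finite.of_equiv _ SemidirectProduct.equivProd.symm
  have hcard := sq_eq_card ρ
  rw [Fintype.card_fin] at hcard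
  have ha : NeZero a := ⟨by rintro rfl; exact Nat.card_pos.ne hcard⟩
  set r : N → Matrix (Fin a) (Fin a) ℂ := fun n => ρ (basis _ n) with hr
  have hrmul : ∀ n m, r n * r m = (F.1 (.inl n) (.inl m) : ℂ) • r (n * m) := fun n m => by
    simp only [hr]
    rw [← map_mul, basis_mul_basis, map_smul]; rfl
  have hr1 : r 1 = (F.1 1 1 : ℂ) • 1 := by
    simp only [hr]
    rw [basis_one, map_smul, map_one, comapCocycle_apply, map_one]
  have hrspan : Submodule.span ℂ (Set.range r) = ⊤ := by
    have : Set.range r = ρ.toLinearMap '' Set.range (basis _) := by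
      rw [← Set.range_comp]; rfl
    rw [this, Submodule.span_image, (basis _).span_eq, Submodule.map_top, LinearMap.range_eq_top]
    exact ρ.surjective
  choose T hT using exists_conj_units F ρ
  -- the matrices `T_k` form a projective representation of `K`
  have hd : ∀ k l, ∃ d : ℂˣ, (T k : Matrix (Fin a) (Fin a) ℂ) * T l =
      (d : ℂ) • (T (k * l) : Matrix (Fin a) (Fin a) ℂ) := by
    intro k l
    -- `T_k T_l` and `T_{kl}` induce the same conjugation on the `r n`, which span, so `U` is
    -- central and hence scalar.
    set U : (Matrix (Fin a) (Fin a) ℂ)ˣ := (T (k * l))⁻¹ * (T k * T l) with hU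
    have hUr : ∀ n, (U : Matrix (Fin a) (Fin a) ℂ) * r n = r n * U := by
      intro n
      have h1 : ((T k * T l : (Matrix (Fin a) (Fin a) ℂ)ˣ) : Matrix (Fin a) (Fin a) ℂ) * r n =
          (conjScalar F (.inr (k * l)) (.inl n) (.inl (η (k * l) n)) : ℂ) •
            (r (η (k * l) n) * (T k * T l : (Matrix (Fin a) (Fin a) ℂ)ˣ)) := by
        have h := conjScalar_comp (f := F) (inr_mul_inl l n) (inr_mul_inl k (η l n))
        rw [← map_mul] at h
        rw [Units.val_mul, mul_assoc, hT, mul_smul_comm, ← mul_assoc, hT, smul_mul_assoc,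
          smul_smul, mul_assoc, mul_comm (Units.val _), ← Units.val_mul, h, map_mul η,
          MulAut.mul_apply]
      have h2 : (T (k * l) : Matrix (Fin a) (Fin a) ℂ) * (r n * U) =
          (conjScalar F (.inr (k * l)) (.inl n) (.inl (η (k * l) n)) : ℂ) •
            (r (η (k * l) n) * (T k * T l : (Matrix (Fin a) (Fin a) ℂ)ˣ)) := by
        rw [← mul_assoc, hT, smul_mul_assoc, mul_assoc, ← Units.val_mul, hU, mul_inv_cancel_left]
      rw [← (T (k * l)).isUnit.mul_right_inj, h2, ← h1, ← mul_assoc, ← Units.val_mul, hU,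
        mul_inv_cancel_left]
    have hUc : (U : Matrix (Fin a) (Fin a) ℂ) ∈
        Subalgebra.center ℂ (Matrix (Fin a) (Fin a) ℂ) := by
      rw [Subalgebra.mem_center_iff]
      intro M
      have hM : M ∈ Submodule.span ℂ (Set.range r) := hrspan ▸ Submodule.mem_top
      induction hM using Submodule.span_induction with
      | mem x hx => obtain ⟨n, rfl⟩ := hx; exact (hUr n).symm
      | zero => simp
      | add x y _ _ hx hy => rw [add_mul, mul_add, hx, hy]
      | smul c x _ hx => rw [smul_mul_assoc, mul_smul_comm, hx]
    obtain ⟨d, hd⟩ := Algebra.mem_bot.1 (Algebra.IsCentral.out hUc)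
    have hd0 : d ≠ 0 := by
      rintro rfl
      rw [map_zero] at hd
      exact U.ne_zero hd.symm
    refine ⟨Units.mk0 d hd0, ?_⟩
    rw [Units.val_mk0, ← mul_one (T (k * l) : Matrix (Fin a) (Fin a) ℂ), ← mul_smul_comm,
      ← Algebra.algebraMap_eq_smul_one, hd, ← Units.val_mul, ← Units.val_mul, hU,
      mul_inv_cancel_left]
  choose d hd using hd
  -- Associativity of `T_k T_l T_m`.
  have hdc : d ∈ twoCocycles K := by
    intro k l m
    have h : ((d k l * d (k * l) m : ℂˣ) : ℂ) •
          (T (k * l * m) : Matrix (Fin a) (Fin a) ℂ) =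
        ((d l m * d k (l * m) : ℂˣ) : ℂ) • (T (k * l * m) : Matrix (Fin a) (Fin a) ℂ) := by
      rw [Units.val_mul, Units.val_mul, mul_smul, ← hd, ← smul_mul_assoc, ← hd, mul_smul,
        mul_assoc k l m, ← hd, ← mul_smul_comm, ← hd, mul_assoc]
    exact Units.ext (smul_left_injective ℂ (T (k * l * m)).ne_zero h)
  -- In `ℂ^F(N ⋊ K)` the elements `v_k = T_k⁻¹ u_k` satisfy `v_k v_l = F(k, l) d(k, l)⁻¹ v_{kl}`.
  refine ⟨comapCocycle SemidirectProduct.inr F * ⟨d, hdc⟩⁻¹, fun γ => ?_⟩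
  set β : twoCocycles K := comapCocycle SemidirectProduct.inr F * ⟨d, hdc⟩⁻¹ with hβ
  have hβa : ∀ k l, (β * γ).1 k l = F.1 (.inr k) (.inr l) * (d k l)⁻¹ * γ.1 k l := fun _ _ => rfl
  set B := TwistedGroupAlgebra (β * γ)
  -- Since `u_n u_k = F(n, k) u_{nk}` and `u_k = T_k v_k`, the image of `u_{nk}` must be `F(n, k)⁻¹
  -- (r_n T_k ⊗ v_k)`.
  let s : N ⋊[η] K → ℂˣ := fun g => (F.1 (.inl g.left) (.inr g.right))⁻¹
  let S : N ⋊[η] K → Matrix (Fin a) (Fin a) B := fun g =>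
    (s g : ℂ) • tmulMatrix (r g.left * (T g.right : Matrix (Fin a) (Fin a) ℂ)) (basis (β * γ) g.right)
  have hSmul : ∀ g h, S g * S h =
      ((F * comapCocycle SemidirectProduct.rightHom γ).1 g h : ℂ) • S (g * h) := by
    rintro ⟨n, k⟩ ⟨m, l⟩
    have e1 : r n * T k * (r m * T l) =
        ((conjScalar F (.inr k) (.inl m) (.inl (η k m)) * F.1 (.inl n) (.inl (η k m)) * d k l :
          ℂˣ) : ℂ) • (r (n * η k m) * T (k * l)) := by
      rw [mul_assoc, ← mul_assoc (T k : Matrix (Fin a) (Fin a) ℂ), hT, smul_mul_assoc,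
        mul_smul_comm, mul_assoc (r (η k m)), hd, mul_smul_comm, mul_smul_comm, ← mul_assoc,
        hrmul, smul_mul_assoc, smul_smul, smul_smul]
      push_cast
      congr 1
      ring
    have e2 := cocycle_mul_mul (f := F) (n := .inl n) (l := .inr l) (inr_mul_inl k m)
    rw [← SemidirectProduct.mk_eq_inl_mul_inr, ← SemidirectProduct.mk_eq_inl_mul_inr, ← map_mul,
      ← map_mul] at e2
    simp only [S, s, SemidirectProduct.mul_left, SemidirectProduct.mul_right]
    rw [smul_mul_smul_comm, tmulMatrix_mul, e1, basis_mul_basis, map_smul, map_smul,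
      LinearMap.smul_apply, smul_smul, smul_smul, smul_smul, hβa]
    congr 1
    change _ = ((F.1 ⟨n, k⟩ ⟨m, l⟩ * γ.1 k l : ℂˣ) : ℂ) * _
    simp only [Units.ext_iff, Units.val_mul, Units.val_inv_eq_inv_val] at e2 ⊢
    field_simp
    linear_combination (-1 : ℂ) * e2
  have hSone : S 1 = ((F * comapCocycle SemidirectProduct.rightHom γ).1 1 1 : ℂ) • 1 := by
    have hT1 : (T 1 : Matrix (Fin a) (Fin a) ℂ) = (d 1 1 : ℂ) • 1 := by
      have h := hd 1 1
      rw [mul_one, ← one_mul ((d 1 1 : ℂ) • _), mul_smul_comm, ← smul_mul_assoc] at h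
      exact (T 1).isUnit.mul_left_inj.1 h
    simp only [S, s, SemidirectProduct.one_left, SemidirectProduct.one_right]
    rw [hr1, hT1, smul_mul_smul_comm, one_mul, basis_one, map_smul, map_smul,
      LinearMap.smul_apply, tmulMatrix_one, smul_smul, smul_smul, hβa, map_one, map_one]
    congr 1
    change _ = ((F.1 1 1 * γ.1 1 1 : ℂˣ) : ℂ)
    push_cast
    field_simp
  let Φ := lift S hSone hSmul
  have hΦ : Function.Surjective Φ := by
    -- As `T_k` is invertible and the `r n` span, the `r n * T_k` span all matrices for each fixed
    -- `k`.
    have key : ∀ (M : Matrix (Fin a) (Fin a) ℂ) (b : B), tmulMatrix M b ∈ Φ.range := by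
      intro M b
      induction b using basis_induction with
      | coe k =>
        obtain ⟨M, rfl⟩ : ∃ M', M = M' * T k := ⟨M * ((T k)⁻¹ : _ˣ), by simp [mul_assoc]⟩
        have hM : M ∈ Submodule.span ℂ (Set.range r) := hrspan ▸ Submodule.mem_top
        induction hM using Submodule.span_induction with
        | mem x hx =>
          obtain ⟨n, rfl⟩ := hx
          refine ⟨((s ⟨n, k⟩)⁻¹ : ℂˣ).val • basis _ ⟨n, k⟩, ?_⟩
          change Φ _ = _
          rw [map_smul, lift_basis]
          simp only [S]
          rw [smul_smul, ← Units.val_mul, inv_mul_cancel, Units.val_one, one_smul]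
        | zero => rw [zero_mul, map_zero]; exact zero_mem _
        | add x y _ _ hx hy => rw [add_mul, map_add]; exact add_mem hx hy
        | smul c x _ hx =>
          rw [smul_mul_assoc, map_smul]; exact Subalgebra.smul_mem _ hx c
      | zero => rw [map_zero]; exact zero_mem _
      | add x y hx hy => rw [map_add]; exact add_mem hx hy
      | smul c x hx => rw [map_smul]; exact Subalgebra.smul_mem _ hx c
    intro X
    rw [← AlgHom.mem_range, Matrix.matrix_eq_sum_single X]
    refine sum_mem fun i _ => sum_mem fun j _ => ?_
    convert key (Matrix.single i j 1) (X i j) using 1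
    ext i' j'
    rw [tmulMatrix_apply]
    by_cases h : i = i' ∧ j = j' <;> simp [h]
  have hdim : Module.finrank ℂ
      (TwistedGroupAlgebra (F * comapCocycle SemidirectProduct.rightHom γ)) =
      Module.finrank ℂ (Matrix (Fin a) (Fin a) B) := by
    rw [finrank_eq_card, Module.finrank_matrix, finrank_eq_card, SemidirectProduct.card, ← hcard]
    simp [sq]
  exact isNondegenerateCocycle_iff_of_algEquiv (AlgEquiv.ofBijective Φ
    ⟨(LinearMap.injective_iff_surjective_of_finrank_eq_finrank (f := Φ.toLinearMap) hdim).2 hΦ,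
      hΦ⟩)

/-! ### The criterion for semidirect products. -/

section SemidirectProduct

variable {N : Type u} {K : Type v} [Group N] [Group K] {η : K →* MulAut N}

/-- Restrictions of cocycles on `N ⋊ K` to `N` have `K`-invariant classes. -/
lemma smul_mk_comap_inl (F : twoCocycles (N ⋊[η] K)) (k : K) :
    η k • H2.mk N (comapCocycle SemidirectProduct.inl F) =
      H2.mk N (comapCocycle SemidirectProduct.inl F) := by
  rw [smul_mk, eq_comm, H2.mk_eq_mk_iff]
  -- The cochain records the scalars by which conjugation by `u_k` sends `u_{k⁻¹n}` to a multiple of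
  -- `u_n`.
  refine ⟨fun n => conjScalar F (.inr k) (.inl ((η k)⁻¹ n)) (.inl n), ?_⟩
  have hcomm : ∀ n, (SemidirectProduct.inr k : N ⋊[η] K) * SemidirectProduct.inl ((η k)⁻¹ n) =
      SemidirectProduct.inl n * SemidirectProduct.inr k := fun n => by
    rw [inr_mul_inl, MulAut.apply_inv_self]
  ext1
  funext n m
  have h := conjScalar_mul (f := F) (hcomm n) (hcomm m)
  rw [← map_mul, ← map_mul, ← map_mul] at h
  rw [mul_coboundary_apply, autCocycle_apply, comapCocycle_apply, comapCocycle_apply, ← mul_assoc,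
    mul_inv_eq_iff_eq_mul, ← h, mul_comm]

/-- The extension to `N ⋊ K` of a `K`-invariant cocycle of `N`. -/
def extendCocycle (f : twoCocycles N) (hf : ∀ k, autCocycle (η k) f = f) :
    twoCocycles (N ⋊[η] K) :=
  ⟨fun g h => f.1 g.left (η g.right h.left), fun g h j => by
    have hinv : ∀ k x y, f.1 (η k x) (η k y) = f.1 x y := fun k x y => by
      conv_lhs => rw [← hf k]
      rw [autCocycle_apply, MulAut.inv_apply_self, MulAut.inv_apply_self]
    have h1 := f.2 g.left (η g.right h.left) (η g.right (η h.right j.left))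
    rw [hinv] at h1
    simpa using h1⟩

lemma comap_inl_extendCocycle (f : twoCocycles N) (hf : ∀ k, autCocycle (η k) f = f) :
    comapCocycle SemidirectProduct.inl (extendCocycle f hf) = f := by
  ext1
  funext n m
  simp [comapCocycle_apply, extendCocycle]

lemma IsSymplectic.isOfCentralType (h : IsSymplectic η) : IsOfCentralType N := by
  obtain ⟨_, ⟨f, -, hf⟩, -⟩ := h
  exact ⟨f, hf⟩

theorem isOfCentralType_semidirectProduct_iff [Finite N] [Finite K]
    (hcop : (Nat.card N).Coprime (Nat.card K)) :
    IsOfCentralType (N ⋊[η] K) ↔ IsOfCentralType K ∧ IsSymplectic η := by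
  have : Finite (N ⋊[η] K) := Finite.of_equiv _ SemidirectProduct.equivProd.symm
  constructor
  · rintro ⟨f, hf⟩
    have hN := hf.comap_of_coprime SemidirectProduct.inl_injective SemidirectProduct.card hcop
    obtain ⟨β, hβ⟩ := exists_cocycle_nondegenerate_iff f hN
    have h1 := hβ 1
    rw [map_one, mul_one] at h1
    refine ⟨⟨_, h1.1 hf⟩, _, ⟨_, rfl, hN⟩, ?_⟩
    rintro _ ⟨k, rfl⟩
    exact smul_mk_comap_inl f k
  · rintro ⟨⟨κ, hκ⟩, c, hc, hinv⟩
    obtain ⟨f, rfl, hf⟩ := exists_invariant_cocycle η hcop c hinv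
    have hN := hc.isNondegenerateCocycle
    rw [← comap_inl_extendCocycle f hf] at hN
    obtain ⟨β, hβ⟩ := exists_cocycle_nondegenerate_iff _ hN
    -- The inflated factor cancels the obstruction `β` and leaves the non-degenerate `κ` on `K`.
    have h1 := hβ (β⁻¹ * κ)
    rw [mul_inv_cancel_left] at h1
    exact ⟨_, h1.2 hκ⟩

end SemidirectProduct

/-! ### Commutative groups: cocycles and alternating bicharacters. -/

/-- A symmetric cocycle on a finite commutative group is a coboundary. -/
lemma exists_eq_coboundary_of_symm {A : Type u} [Group A] [Finite A]
    (hA : ∀ x y : A, x * y = y * x) {f : twoCocycles A} (hf : ∀ x y, f.1 x y = f.1 y x) : ∃ c, coboundary A c = f := by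
  let : CommRing (TwistedGroupAlgebra f) :=
    { (inferInstance : Ring (TwistedGroupAlgebra f)) with
      mul_comm := fun a b => by
        induction a using TwistedGroupAlgebra.basis_induction with
        | coe x =>
          induction b using TwistedGroupAlgebra.basis_induction with
          | coe y =>
            rw [TwistedGroupAlgebra.basis_mul_basis, TwistedGroupAlgebra.basis_mul_basis, hA x y,
              hf x y]
          | zero => simp
          | add a b ha hb => rw [add_mul, mul_add, ha, hb]
          | smul r a ha => rw [smul_mul_assoc, mul_smul_comm, ha]
        | zero => simp
        | add a b ha hb => rw [add_mul, mul_add, ha, hb]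
        | smul r a ha => rw [smul_mul_assoc, mul_smul_comm, ha] }
  -- The residue field is finite over `ℂ`, hence equal to `ℂ`. The resulting character `χ` satisfies
  -- `χ(u_x) χ(u_y) = f(x, y) χ(u_{xy})` with nonzero values, which exhibits `f` as a coboundary.
  obtain ⟨M, hM⟩ := Ideal.exists_maximal (TwistedGroupAlgebra f)
  let := Ideal.Quotient.field M
  have hbij : Function.Bijective (Algebra.ofId ℂ (TwistedGroupAlgebra f ⧸ M)) :=
    IsAlgClosed.algebraMap_bijective_of_isIntegral
  let χ : TwistedGroupAlgebra f →ₐ[ℂ] ℂ :=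
    (AlgEquiv.ofBijective _ hbij).symm.toAlgHom.comp (Ideal.Quotient.mkₐ ℂ M)
  have hχ : ∀ x, IsUnit (χ (TwistedGroupAlgebra.basis f x)) := fun x =>
    (TwistedGroupAlgebra.isUnit_basis f x).map χ
  refine ⟨fun x => (hχ x).unit, ?_⟩
  ext1
  funext x y
  rw [coboundary_apply, mul_inv_eq_iff_eq_mul]
  ext
  simp only [Units.val_mul, IsUnit.unit_spec]
  rw [← map_mul, TwistedGroupAlgebra.basis_mul_basis, map_smul, smul_eq_mul]

section Commutative

variable {A : Type u} [Group A] (hA : ∀ x y : A, x * y = y * x)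

/-- The alternating bicharacter `(x, y) ↦ f(x, y) / f(y, x)` of a cocycle on a commutative
group. -/
def alt (f : twoCocycles A) : A →* A →* ℂˣ :=
  MonoidHom.mk' (fun x => MonoidHom.mk' (fun y => conjScalar f x y y) fun y z => by
      have h := conjScalar_mul (f := f) (hA x y) (hA x z)
      rw [mul_comm] at h
      exact (mul_left_cancel h).symm)
    fun x y => MonoidHom.ext fun z => (conjScalar_comp (hA y z) (hA x z)).symm

lemma alt_apply (f : twoCocycles A) (x y : A) : alt hA f x y = f.1 x y * (f.1 y x)⁻¹ := rfl

lemma alt_self (f : twoCocycles A) (x : A) : alt hA f x x = 1 := mul_inv_cancel _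

lemma alt_swap (f : twoCocycles A) (x y : A) : alt hA f y x = (alt hA f x y)⁻¹ := by
  rw [alt_apply, alt_apply, mul_inv_rev, inv_inv]

lemma alt_autCocycle (φ : MulAut A) (f : twoCocycles A) (x y : A) :
    alt hA (autCocycle φ f) x y = alt hA f (φ⁻¹ x) (φ⁻¹ y) := rfl

lemma repr_basis_mul (f : twoCocycles A) (x : TwistedGroupAlgebra f) (g h : A) :
    (TwistedGroupAlgebra.basis f).repr (TwistedGroupAlgebra.basis f g * x) (g * h) =
      f.1 g h * (TwistedGroupAlgebra.basis f).repr x h := by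
  have : (Finsupp.lapply (g * h) ∘ₗ (TwistedGroupAlgebra.basis f).repr.toLinearMap) ∘ₗ
        LinearMap.mulLeft ℂ (TwistedGroupAlgebra.basis f g) =
      (f.1 g h : ℂ) • (Finsupp.lapply h ∘ₗ (TwistedGroupAlgebra.basis f).repr.toLinearMap) := by
    refine (TwistedGroupAlgebra.basis f).ext fun k => ?_
    by_cases hk : k = h
    · subst hk; simp [TwistedGroupAlgebra.basis_mul_basis]
    · simp [TwistedGroupAlgebra.basis_mul_basis, hk]
  simpa using LinearMap.congr_fun this x

/-- A cocycle on a commutative group is non-degenerate if and only if its alternating bicharacter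
is. -/
lemma isNondegenerateCocycle_iff_alt [Finite A] {f : twoCocycles A} :
    IsNondegenerateCocycle f ↔ ∀ x, (∀ y, alt hA f x y = 1) → x = 1 := by
  rw [isNondegenerateCocycle_iff_isCentral]
  constructor
  · intro h x hx
    have hc : TwistedGroupAlgebra.basis f x ∈ Subalgebra.center ℂ (TwistedGroupAlgebra f) := by
      rw [Subalgebra.mem_center_iff]
      intro b
      induction b using TwistedGroupAlgebra.basis_induction with
      | coe y =>
        rw [TwistedGroupAlgebra.basis_mul_basis, TwistedGroupAlgebra.basis_mul_basis, hA y x,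
          mul_inv_eq_one.1 (hx y)]
      | zero => simp
      | add a b ha hb => rw [add_mul, mul_add, ha, hb]
      | smul r a ha => rw [smul_mul_assoc, mul_smul_comm, ha]
    obtain ⟨r, hr⟩ := Algebra.mem_bot.1 (h.out hc)
    rw [Algebra.algebraMap_eq_smul_one, TwistedGroupAlgebra.one_def] at hr
    by_contra hx1
    have := congrArg (fun z => (TwistedGroupAlgebra.basis f).repr z x) hr
    simp [Ne.symm hx1] at this
  · refine fun h => ⟨fun z hz => ?_⟩
    -- Comparing coefficients of `u_y z` and `z u_y` at `yx` shows that any `x` in the support of a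
    -- central `z` lies in the radical of the bicharacter.
    have hz1 : ∀ x, x ≠ 1 → (TwistedGroupAlgebra.basis f).repr z x = 0 := by
      intro x hx
      by_contra h0
      refine hx (h x fun y => ?_)
      have h1 := repr_basis_mul f z y x
      rw [Subalgebra.mem_center_iff.1 hz, hA y x, TwistedGroupAlgebra.repr_mul_basis_one,
        mul_comm] at h1
      exact mul_inv_eq_one.2 (Units.ext (mul_right_cancel₀ h0 h1))
    refine Algebra.mem_bot.2 ⟨(TwistedGroupAlgebra.basis f).repr z 1 * f.1 1 1, ?_⟩
    refine (TwistedGroupAlgebra.basis f).ext_elem fun x => ?_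
    rw [Algebra.algebraMap_eq_smul_one, mul_smul, ← TwistedGroupAlgebra.basis_one]
    by_cases hx : x = 1
    · subst hx; simp
    · simp [hz1 x hx, Ne.symm hx]

/-- On a finite commutative group, cohomology classes are determined by their alternating
bicharacters. -/
lemma H2.mk_eq_mk_iff_alt [Finite A] {f f' : twoCocycles A} :
    H2.mk A f = H2.mk A f' ↔ alt hA f = alt hA f' := by
  constructor
  · intro h
    obtain ⟨c, rfl⟩ := H2.mk_eq_mk_iff.1 h
    ext x y
    rw [alt_apply, alt_apply, mul_coboundary_apply, mul_coboundary_apply, hA y x, mul_comm (c y),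
      mul_inv_rev, mul_assoc, mul_inv_cancel_left]
  · intro h
    -- Equal bicharacters make the quotient `f⁻¹ f'` symmetric.
    obtain ⟨c, hc⟩ := exists_eq_coboundary_of_symm hA (f := f⁻¹ * f') fun x y => by
      have hxy : f.1 x y * (f.1 y x)⁻¹ = f'.1 x y * (f'.1 y x)⁻¹ :=
        DFunLike.congr_fun (DFunLike.congr_fun h x) y
      change (f.1 x y)⁻¹ * f'.1 x y = (f.1 y x)⁻¹ * f'.1 y x
      rw [mul_inv_eq_iff_eq_mul] at hxy
      rw [hxy]
      simp only [mul_inv_rev, inv_inv]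
      rw [mul_assoc, inv_mul_cancel_right]
    exact H2.mk_eq_mk_iff.2 ⟨c, by rw [hc, mul_inv_cancel_left]⟩

end Commutative

/-! ### The case of `C_m × C_m`: symplectic means determinant one. -/

section RankTwo

variable {m : ℕ}

lemma exists_zpow_gen (x : CyclicSq m) : ∃ a b : ℤ, x = gen m 0 ^ a * gen m 1 ^ b ∧
    exponents m x 0 = a ∧ exponents m x 1 = b := by
  obtain ⟨a, b⟩ := x
  obtain ⟨a, rfl⟩ := Multiplicative.ofAdd.surjective a
  obtain ⟨b, rfl⟩ := Multiplicative.ofAdd.surjective b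
  obtain ⟨a, rfl⟩ := ZMod.intCast_surjective a
  obtain ⟨b, rfl⟩ := ZMod.intCast_surjective b
  refine ⟨a, b, ?_, rfl, rfl⟩
  ext <;> simp [gen, ← ofAdd_zsmul]

lemma mem_SL2_iff (φ : MulAut (CyclicSq m)) : φ ∈ SL2 m ↔ (autMatrix m φ).det = 1 :=
  MonoidHom.mem_ker

lemma mul_comm_of_mulEquiv {N : Type u} [Group N] (e : N ≃* CyclicSq m) (x y : N) :
    x * y = y * x :=
  e.injective (by rw [map_mul, map_mul, mul_comm])

variable {N : Type u} [Group N] (e : N ≃* CyclicSq m)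

/-- An alternating form in rank two is its value on the generators raised to a 2×2 determinant. -/
lemma alt_eq_zpow (f : twoCocycles N) (a b c d : ℤ) :
    alt (mul_comm_of_mulEquiv e) f (e.symm (gen m 0 ^ a * gen m 1 ^ b))
        (e.symm (gen m 0 ^ c * gen m 1 ^ d)) =
      alt (mul_comm_of_mulEquiv e) f (e.symm (gen m 0)) (e.symm (gen m 1)) ^ (a * d - b * c) := by
  simp only [map_mul, map_zpow, MonoidHom.mul_apply, MonoidHom.zpow_apply, alt_self]
  rw [alt_swap _ f (e.symm (gen m 0)) (e.symm (gen m 1))]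
  simp only [one_zpow, one_mul, mul_one, inv_zpow', ← zpow_mul, ← zpow_add]
  congr 1
  ring

/-- If the `d`-th power of the value on `(σ, τ)` is trivial, then `σ ^ d` pairs trivially with
everything, so `σ ^ d = 1` by non-degeneracy. -/
lemma dvd_of_alt_zpow_eq_one [Finite N] {f : twoCocycles N} (hf : IsNondegenerateCocycle f) {d : ℤ}
    (hd : alt (mul_comm_of_mulEquiv e) f (e.symm (gen m 0)) (e.symm (gen m 1)) ^ d = 1) :
    ((d : ℤ) : ZMod m) = 0 := by
  have h := (isNondegenerateCocycle_iff_alt (mul_comm_of_mulEquiv e)).1 hf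
    (e.symm (gen m 0 ^ d * gen m 1 ^ (0 : ℤ))) fun y => by
      obtain ⟨a, b, hab, -⟩ := exists_zpow_gen (e y)
      rw [← e.symm_apply_apply y, hab, alt_eq_zpow, zero_mul, sub_zero, zpow_mul, hd, one_zpow]
  have h1 := congrArg (fun x => exponents m (e x) 0) h
  simpa [exponents, gen] using h1

/-- The integer `D` lifts `det [φ]`, so that it can serve as an exponent. -/
lemma alt_gen_image (f : twoCocycles N) (φ : MulAut N) : ∃ D : ℤ,
    (D : ZMod m) = (autMatrix m (MulAut.congr e φ)).det ∧
    alt (mul_comm_of_mulEquiv e) f (φ (e.symm (gen m 0))) (φ (e.symm (gen m 1))) =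
      alt (mul_comm_of_mulEquiv e) f (e.symm (gen m 0)) (e.symm (gen m 1)) ^ D := by
  obtain ⟨a, b, h1, ha, hb⟩ := exists_zpow_gen (e (φ (e.symm (gen m 0))))
  obtain ⟨c, d, h2, hc, hd⟩ := exists_zpow_gen (e (φ (e.symm (gen m 1))))
  refine ⟨a * d - b * c, ?_, ?_⟩
  · rw [Matrix.det_fin_two]
    push_cast
    rw [← ha, ← hb, ← hc, ← hd]
    change _ = exponents m (e (φ (e.symm (gen m 0)))) 0 * exponents m (e (φ (e.symm (gen m 1)))) 1 -
      exponents m (e (φ (e.symm (gen m 1)))) 0 * exponents m (e (φ (e.symm (gen m 0)))) 1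
    ring
  · rw [← alt_eq_zpow, ← h1, ← h2, e.symm_apply_apply, e.symm_apply_apply]

variable (m) in
/-- The standard additive character of `ℤ/m`, with values in the units of `ℂ`. -/
def stdUnitChar [NeZero m] : Multiplicative (ZMod m) →* ℂˣ :=
  (ZMod.stdAddChar (N := m)).toMonoidHom.toHomUnits

lemma coe_stdUnitChar [NeZero m] (a : ZMod m) :
    (stdUnitChar m (Multiplicative.ofAdd a) : ℂ) = ZMod.stdAddChar a := rfl

/-- The cocycle `(x, y) ↦ ζ ^ (x₀ y₁)`, where `ζ` is a primitive `m`-th root of unity. -/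
def stdCocycle [NeZero m] : twoCocycles N :=
  ⟨fun x y => stdUnitChar m
      (Multiplicative.ofAdd (exponents m (e x) 0 * exponents m (e y) 1)), fun x y z => by
    have h : ∀ x y i, exponents m (e (x * y)) i = exponents m (e x) i + exponents m (e y) i :=
      fun x y i => by rw [map_mul]; fin_cases i <;> rfl
    simp only [← map_mul (stdUnitChar m), ← ofAdd_add, h]
    congr 2
    ring⟩

lemma alt_stdCocycle [NeZero m] (x y : N) :
    (alt (mul_comm_of_mulEquiv e) (stdCocycle e) x y : ℂ) =
      ZMod.stdAddChar (exponents m (e x) 0 * exponents m (e y) 1 -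
        exponents m (e x) 1 * exponents m (e y) 0) := by
  rw [alt_apply, stdCocycle]
  dsimp only
  rw [← map_inv, ← map_mul, ← ofAdd_neg, ← ofAdd_add, coe_stdUnitChar]
  congr 1
  ring

lemma isNondegenerateCocycle_stdCocycle [NeZero m] [Finite N] :
    IsNondegenerateCocycle (stdCocycle e) := by
  rw [isNondegenerateCocycle_iff_alt (mul_comm_of_mulEquiv e)]
  intro x hx
  have h0 : exponents m (e x) 0 = 0 := by
    have h := congrArg Units.val (hx (e.symm (gen m 1)))
    rw [alt_stdCocycle] at h
    refine ZMod.injective_stdAddChar ?_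
    simpa [exponents, gen] using h
  have h1 : exponents m (e x) 1 = 0 := by
    have h := congrArg Units.val (hx (e.symm (gen m 0)))
    rw [alt_stdCocycle] at h
    refine neg_injective (ZMod.injective_stdAddChar ?_)
    simpa [exponents, gen] using h
  exact e.injective (by rw [map_one]; exact Prod.ext h0 h1)

/-- The exponent of the standard form is the determinant of a pair of vectors, which `φ` multiplies
by `det [φ] = 1`. -/
lemma alt_stdCocycle_image [NeZero m] {φ : MulAut N} (hφ : MulAut.congr e φ ∈ SL2 m) (x y : N) :
    alt (mul_comm_of_mulEquiv e) (stdCocycle e) (φ x) (φ y) =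
      alt (mul_comm_of_mulEquiv e) (stdCocycle e) x y := by
  ext
  rw [alt_stdCocycle, alt_stdCocycle]
  congr 1
  have key : ∀ x i, exponents m (e (φ x)) i =
      autMatrix m (MulAut.congr e φ) i 0 * exponents m (e x) 0 +
        autMatrix m (MulAut.congr e φ) i 1 * exponents m (e x) 1 := fun x i => by
    have h := exponents_apply m (MulAut.congr e φ) (e x) i
    rw [Fin.sum_univ_two] at h
    rw [show e (φ x) = MulAut.congr e φ (e x) by simp [MulAut.congr], h]
    rfl
  rw [mem_SL2_iff, Matrix.det_fin_two] at hφ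
  rw [key, key, key, key]
  linear_combination (exponents m (e x) 0 * exponents m (e y) 1 -
        exponents m (e x) 1 * exponents m (e y) 0) * hφ

/-- An action on `C_m × C_m` is symplectic if and only if it is by automorphisms of
determinant `1`. -/
theorem isSymplectic_iff_le_SL2 [Finite N] {K : Type v} [Group K] (η : K →* MulAut N) :
    IsSymplectic η ↔ η.range.map (MulAut.congr e).toMonoidHom ≤ SL2 m := by
  -- For `m = 0` the group would be `ℤ × ℤ`, which is infinite.
  have hm : NeZero m := ⟨by
    rintro rfl
    have : Finite (CyclicSq 0) := Finite.of_equiv _ e.toEquiv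
    have : Finite ℤ := Finite.of_injective
      (fun a : ℤ => ((Multiplicative.ofAdd a, 1) : CyclicSq 0)) fun a b h => congrArg Prod.fst h
    exact not_finite ℤ⟩
  constructor
  · rintro ⟨c, hc, hinv⟩
    obtain ⟨f, rfl⟩ := H2.mk_surjective c
    have hf := hc.isNondegenerateCocycle
    rintro _ ⟨φ, hφ, rfl⟩
    have h1 : H2.mk N (autCocycle φ f) = H2.mk N f := hinv hφ
    rw [H2.mk_eq_mk_iff_alt (mul_comm_of_mulEquiv e)] at h1
    obtain ⟨D, hD, h2⟩ := alt_gen_image e f φ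
    -- With `z` the value on `(σ, τ)`, invariance turns `h2` into `z = z ^ D`, whence `D ≡ 1` modulo
    -- `m`.
    rw [← h1, alt_autCocycle, MulAut.inv_apply_self, MulAut.inv_apply_self, h1] at h2
    have h3 := dvd_of_alt_zpow_eq_one e hf (d := D - 1) (by
      rw [zpow_sub_one, ← h2, mul_inv_cancel])
    refine (mem_SL2_iff _).2 (hD.symm.trans ?_)
    simpa [sub_eq_zero] using h3
  · intro h
    refine ⟨_, ⟨_, rfl, isNondegenerateCocycle_stdCocycle e⟩, ?_⟩
    intro φ hφ
    have hφ' : MulAut.congr e φ⁻¹ ∈ SL2 m := h ⟨φ⁻¹, inv_mem hφ, rfl⟩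
    change H2.mk N (autCocycle φ _) = _
    rw [H2.mk_eq_mk_iff_alt (mul_comm_of_mulEquiv e)]
    ext1 x
    ext1 y
    exact alt_stdCocycle_image e hφ' x y

end RankTwo

end CentralType

end

theorem mainTheorem5 {N : Type u} {K : Type v} [Group N] [Group K] [Finite N] [Finite K]
    (η : K →* MulAut N) (hcop : (Nat.card N).Coprime (Nat.card K)) :
    (CentralType.IsOfCentralType (N ⋊[η] K) ↔
      CentralType.IsOfCentralType N ∧ CentralType.IsOfCentralType K ∧
        CentralType.IsSymplectic η) ∧
    (∀ (m : ℕ) (e : N ≃* CentralType.CyclicSq m),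
      (CentralType.IsOfCentralType (N ⋊[η] K) ↔
        CentralType.IsOfCentralType K ∧
          η.range.map (MulAut.congr e).toMonoidHom ≤ CentralType.SL2 m)) := by
  refine ⟨?_, fun m e => ?_⟩
  · rw [CentralType.isOfCentralType_semidirectProduct_iff hcop]
    exact ⟨fun h => ⟨h.2.isOfCentralType, h⟩, fun h => h.2⟩
  · rw [CentralType.isOfCentralType_semidirectProduct_iff hcop,
      CentralType.isSymplectic_iff_le_SL2 e]
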